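/- Let $r\ge 2$, $k\ge 3$ and $n_1\ge 2k-1$ be integers. Let $\mathcal{K}=\mathcal{K}_{n_1,\ldots,n_1}$ be the complete $r$-partite $r$-uniform hypergraph on disjoint vertex classes $V_1,\ldots,V_r$ with $|V_i|=n_1$ for every $i$; its edges are all the sets $e\subseteq V_1\cup\cdots\cup V_r$ with $|e\cap V_i|=1$ for every $i$. A $k$-matching is a set of $k$ pairwise disjoint edges; in an edge-colouring of $\mathcal{K}$ it is rainbow if its edges have pairwise different colours. Let $ar_r(\mathcal{K},M_k)$ be the maximum number of colours that occur in an edge-colouring of $\mathcal{K}$ without a rainbow $k$-matching. Then $$ar_r(\mathcal{K}_{n_1,\ldots,n_1},M_k)=(k-2)n_1^{r-1}+1.$$ Moreover, an edge-colouring of $\mathcal{K}$ in which exactly $(k-2)n_1^{r-1}+1$ colours occur contains no rainbow $k$-matching if and only if it is a colouring $\phi_r$, that is, if and only if there are a class $V_i$ and a set $S\subseteq V_i$ with $|S|=k-2$ such that the edges of $\mathcal{K}$ that meet $S$ have pairwise different colours and all the other edges of $\mathcal{K}$ have one and the same further colour, which occurs on no edge that meets $S$. -/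

import Mathlib

namespace PartiteAntiRamsey

/-- Vertices of an `r`-partite hypergraph whose `i`-th class has `n i` vertices. -/
abbrev Vertex {r : ℕ} (n : Fin r → ℕ) : Type := Σ i : Fin r, Fin (n i)

/-- The complete `r`-partite `r`-uniform hypergraph with class sizes `n`: its edges are all sets
of vertices that meet every class in exactly one vertex (so they have exactly `r` elements). -/
def completePartite {r : ℕ} (n : Fin r → ℕ) : Hypergraph (Vertex n) where
  vertexSet := Set.univ
  edgeSet := {e | ∀ i : Fin r, (e ∩ {v | v.1 = i}).ncard = 1}
  subset_vertexSet_of_mem_edgeSet' := fun e _ => Set.subset_univ e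

/-- The number of colors that occur in an edge-coloring of a (finite) hypergraph. -/
noncomputable def numColors {V C : Type*} {H : Hypergraph V} (c : H.edgeSet → C) : ℕ :=
  (Set.range c).ncard

/-- The coloring `c` contains a rainbow `k`-matching: `k` pairwise disjoint edges
with pairwise different colors. -/
def HasRainbowMatching {V C : Type*} {H : Hypergraph V} (k : ℕ) (c : H.edgeSet → C) : Prop :=
  ∃ M : Finset H.edgeSet, M.card = k ∧
    (∀ e ∈ M, ∀ f ∈ M, e ≠ f → Disjoint (e : Set V) (f : Set V)) ∧
    Set.InjOn c (M : Set H.edgeSet)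

/-- `m` is the anti-Ramsey number of the `k`-matching in the (finite) hypergraph `H`: the
largest number of colors in an edge-coloring that contains no rainbow `k`-matching. -/
def IsAntiRamseyNumber {V : Type*} (H : Hypergraph V) (k m : ℕ) : Prop :=
  IsGreatest {t : ℕ | ∃ c : H.edgeSet → ℕ, numColors c = t ∧ ¬ HasRainbowMatching k c} m

/-- The edges of the complete `r`-partite hypergraph that meet the subset `S` of the `i`-th class.
They form the complete `r`-partite hypergraph in which the `i`-th class is replaced by `S`. -/
def edgesMeeting {r : ℕ} {n : Fin r → ℕ} (i : Fin r) (S : Finset (Fin (n i))) :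
    Set (completePartite n).edgeSet :=
  {e | ∃ x ∈ S, (⟨i, x⟩ : Vertex n) ∈ (e : Set (Vertex n))}

/-- The coloring `c` is a coloring `φ_r`: for some set `S` of `k - 2` vertices in a smallest class,
the edges that meet `S` have pairwise different colors, and all the other edges have one
further color. -/
def IsPhi {r : ℕ} {n : Fin r → ℕ} {C : Type*} (k : ℕ) (c : (completePartite n).edgeSet → C) :
    Prop :=
  ∃ i : Fin r, (∀ j : Fin r, n i ≤ n j) ∧
    ∃ S : Finset (Fin (n i)), S.card = k - 2 ∧
      Set.InjOn c (edgesMeeting i S) ∧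
      ∃ c₀ : C, (∀ e ∈ edgesMeeting i S, c e ≠ c₀) ∧ (∀ e ∉ edgesMeeting i S, c e = c₀)

end PartiteAntiRamsey

/-!
# Colorings of complete balanced `r`-partite hypergraphs without a rainbow `k`-matching

An edge of the hypergraph is a function `Fin r → α`, where `α` has `n` elements, and two edges are
disjoint when the functions differ everywhere. Let `c` be a coloring without a rainbow `k`-matching
that uses at least `(k - 2) * n ^ (r - 1) + 1` colors. It suffices to find a class `i`, a set `S` of
`k - 2` vertices of this class and a color `c₀` such that every edge avoiding `S` has color `c₀`:
only `(k - 2) * n ^ (r - 1)` edges meet `S`, so these edges then have pairwise different colors,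
different from `c₀` (`isStarColoring_of_card_le`), and the number of colors is exactly the bound.
The argument needs only `k + 2 ≤ n`, which follows from `2 * k - 1 ≤ n` when `3 ≤ k`.

The proof is by induction on `r`. For each `t`, the edges `e` with `e 0 = e 1 + t` form a
hypergraph with one class fewer, and these `n` pieces cover all edges. So one piece, which may be
taken to be `t = 0`, has more than `(k - 2) * n ^ (r - 2)` colors. By induction it is a star
coloring, given by a set `S` in one of its classes.

* If that class is not the merged one, an edge avoiding `S` whose color is not `c₀` extends to a
  rainbow `k`-matching by `k - 2` edges of the piece through `S` and one edge of color `c₀`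
  (`eq_of_notMem_of_merge_ne_zero`).
* If it is the merged one, write an edge as `(x, y, w)`, so that the piece is the diagonal `x = y`.
  A color that is not on the diagonal occurs only where `x ∈ S` or `y ∈ S`, and for `x ∈ S`, `y ∉ S`
  the edges `(x, y, w)` and `(y, x, w')`, with `w'` a shift of `w`, carry at most one such color.
  Hence all colors but `c₀` are values of a map `pairColor` on the triples with `x ∈ S`. By counting,
  this map is injective and omits `c₀`; further rainbow matchings show that the new colors lie all
  on `(x, y, w)` or all on `(y, x, w)`, so `S` works in one of the two classes
  (`eq_of_notMem_left_or_right`).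

The induction starts with one class, where a coloring with `k - 1` colors need not be a star.
There the coloring of the whole square `α × α` is needed: if fewer than `k - 2` diagonal colors were
used only once, the same count of pairs would leave too few colors (`exists_diagonal_star`).
-/

namespace PartiteAntiRamsey

open Equiv

/-! ### Rainbow families and transversal arguments -/

/-- The coloring `c` of the functions `ι → α` has `k` pairwise disjoint edges of different colors.
The edges are indexed by a set `X` of `k` elements of `α`, so that a matching can be indexed by its
vertices in one of the classes. -/
def HasRainbowFamily {ι α C : Type*} (k : ℕ) (c : (ι → α) → C) : Prop :=
  ∃ (X : Finset α) (u : α → ι → α), X.card = k ∧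
    (∀ a ∈ X, ∀ b ∈ X, a ≠ b → ∀ i, u a i ≠ u b i) ∧ Set.InjOn (fun a => c (u a)) X

/-- A rainbow `k`-matching in a coloring `d` of the triples `(x, y, w)`: it consists of the triples
`(x, π x, ω x)` for `x ∈ X`. Since the partial matching is asked to extend to a perfect one, this is
formally stronger than the existence of a rainbow matching. -/
def HasRainbowPairing {ι α C : Type*} (k : ℕ) (d : α → α → (ι → α) → C) : Prop :=
  ∃ (X : Finset α) (π : Perm α) (ω : α → ι → α), X.card = k ∧
    (∀ a b, a ≠ b → ∀ i, ω a i ≠ ω b i) ∧ Set.InjOn (fun x => d x (π x) (ω x)) X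

lemma exists_perm_apply_eq {α : Type*} [DecidableEq α] {x y a b : α} (hxy : x ≠ y) (hab : a ≠ b) :
    ∃ p : Perm α, p x = a ∧ p y = b := by
  refine ⟨swap (swap x a y) b * swap x a, ?_, ?_⟩
  · rw [Perm.mul_apply, swap_apply_left]
    refine swap_apply_of_ne_of_ne (fun h => hxy ?_) hab
    rw [eq_comm, swap_apply_eq_iff, swap_apply_right] at h
    exact h.symm
  · rw [Perm.mul_apply, swap_apply_left]

lemma exists_disjoint_family {ι α : Type*} [DecidableEq α] {x y : α} (hxy : x ≠ y)
    (w w' : ι → α) (hw : ∀ i, w i ≠ w' i) :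
    ∃ ω : α → ι → α, (∀ a b, a ≠ b → ∀ i, ω a i ≠ ω b i) ∧ ω x = w ∧ ω y = w' := by
  choose p hp using fun i => exists_perm_apply_eq hxy (hw i)
  exact ⟨fun a i => p i a, fun a b hab i h => hab ((p i).injective h),
    funext fun i => (hp i).1, funext fun i => (hp i).2⟩

lemma exists_notMem_of_card_lt {α : Type*} [Fintype α] (T : Finset α)
    (h : T.card < Fintype.card α) : ∃ z, z ∉ T := by
  by_contra! hT
  rw [Finset.eq_univ_iff_forall.2 hT, Finset.card_univ] at h
  exact h.false

/-- The equality case of counting: if the set `R` of colors is covered by `c₀` and the image of `T`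
under `g`, and has more than `T.ncard` elements, then `g` is injective on `T` and avoids `c₀`. -/
lemma injOn_of_subset_insert_image {A C : Type*} {T : Set A} (hT : T.Finite) {R : Set C} {g : A → C}
    {c₀ : C} (hsub : R ⊆ insert c₀ (g '' T)) (h : T.ncard + 1 ≤ R.ncard) :
    Set.InjOn g T ∧ ∀ p ∈ T, g p ≠ c₀ := by
  have hle := h.trans (Set.ncard_le_ncard hsub ((hT.image g).insert c₀))
  have himg := Set.ncard_image_le (f := g) hT
  constructor
  · refine Set.injOn_of_ncard_image_eq ?_ hT
    have := Set.ncard_insert_le c₀ (g '' T)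
    omega
  · rintro p hp rfl
    rw [Set.insert_eq_of_mem (Set.mem_image_of_mem g hp)] at hle
    omega

lemma HasRainbowPairing.swap {ι α C : Type*} {k : ℕ} {d : α → α → (ι → α) → C}
    (h : HasRainbowPairing k fun x y w => d y x w) : HasRainbowPairing k d := by
  obtain ⟨X, π, ω, hX, hω, hinj⟩ := h
  refine ⟨X.map π.toEmbedding, π⁻¹, fun a => ω (π⁻¹ a), by simpa using hX,
    fun a b hab i => hω _ _ (fun h => hab (π⁻¹.injective h)) i, ?_⟩
  rintro a ha b hb hab
  simp only [Finset.coe_map, Set.mem_image, Finset.mem_coe] at ha hb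
  obtain ⟨a, ha, rfl⟩ := ha
  obtain ⟨b, hb, rfl⟩ := hb
  have := hinj ha hb (by simpa using hab)
  rw [this]

section Pairing

variable {ι α C : Type*} [DecidableEq α] {k : ℕ} {d : α → α → (ι → α) → C}
  {S : Finset α} {c₀ : C}

/-- If all diagonal edges outside `S` have color `c₀`, then `k - 1` edges of different colors, none
of them `c₀`, starting at `S` and one further vertex `p`, can be completed by a diagonal edge to a
rainbow `k`-matching. -/
lemma false_of_injOn_insert (hS : S.card + 2 = k) (hd : ¬ HasRainbowPairing k d)
    (hdiag : ∀ z ∉ S, ∀ w, d z z w = c₀) {π : Perm α} {ω : α → ι → α}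
    (hω : ∀ a b, a ≠ b → ∀ i, ω a i ≠ ω b i) {p z : α} (hp : p ∉ S) (hz : z ∉ S) (hzp : z ≠ p)
    (hπ : π z = z) (hinj : Set.InjOn (fun x => d x (π x) (ω x)) (insert p S : Finset α))
    (hne : ∀ x ∈ insert p S, d x (π x) (ω x) ≠ c₀) : False := by
  have hz' : z ∉ insert p S := by simp [hz, hzp]
  have hfz : d z (π z) (ω z) = c₀ := by rw [hπ, hdiag z hz]
  refine hd ⟨insert z (insert p S), π, ω, ?_, hω, ?_⟩
  · rw [Finset.card_insert_of_notMem hz', Finset.card_insert_of_notMem hp]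
    exact hS
  · rw [Finset.coe_insert, Set.injOn_insert (by exact_mod_cast hz')]
    refine ⟨hinj, ?_⟩
    rintro ⟨x, hx, hxz⟩
    exact hne x hx (hxz.trans hfz)

variable [Fintype α]

/-- If the edges starting in `S` have pairwise different colors other than `c₀`, and the diagonal
edges outside `S` have color `c₀`, then every edge that does not start in `S` has color `c₀`. -/
lemma eq_of_notMem_of_injective (hS : S.card + 2 = k) (hn : S.card + 4 ≤ Fintype.card α)
    (hd : ¬ HasRainbowPairing k d) (hdiag : ∀ z ∉ S, ∀ w, d z z w = c₀)
    (hinj : ∀ x ∈ S, ∀ x' ∈ S, ∀ y y' w w', d x y w = d x' y' w' → x = x' ∧ y = y' ∧ w = w')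
    (hne : ∀ x ∈ S, ∀ y w, d x y w ≠ c₀) {x : α} (hx : x ∉ S) (y : α) (w : ι → α) :
    d x y w = c₀ := by
  by_contra hc
  obtain ⟨z, hz⟩ := exists_notMem_of_card_lt (insert x (insert y S))
    ((Finset.card_insert_le _ _).trans_lt
      ((Nat.succ_le_succ (Finset.card_insert_le _ _)).trans_lt (by omega)))
  simp only [Finset.mem_insert, not_or] at hz
  obtain ⟨hzx, hzy, hzS⟩ := hz
  obtain ⟨π, hπx, hπz⟩ := exists_perm_apply_eq (Ne.symm hzx) (Ne.symm hzy)
  obtain ⟨q, hq⟩ : ∃ q : ι → Perm α, ∀ i, q i x = w i :=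
    ⟨fun i => swap x (w i), fun i => swap_apply_left _ _⟩
  let ω : α → ι → α := fun a i => q i a
  have hω : ∀ a b, a ≠ b → ∀ i, ω a i ≠ ω b i := fun a b hab i h => hab ((q i).injective h)
  have hωx : ω x = w := funext hq
  -- a pairing that repeats no color on `S` may only fail because of the color of `(x, y, w)`
  have key : ∀ π : Perm α, π x = y → π z = z → ∃ s ∈ S, d s (π s) (ω s) = d x y w := by
    intro π hπx hπz
    by_contra! hs
    refine false_of_injOn_insert hS hd hdiag hω hx hzS hzx hπz ?_ ?_
    · rw [Finset.coe_insert, Set.injOn_insert (by exact_mod_cast hx)]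
      refine ⟨fun a ha b hb hab => (hinj a ha b hb _ _ _ _ hab).1, ?_⟩
      rintro ⟨a, ha, hax⟩
      refine hs a ha ?_
      simpa only [hπx, hωx] using hax
    · intro a ha
      rcases Finset.mem_insert.1 ha with rfl | ha
      · rwa [hπx, hωx]
      · exact hne a ha _ _
  obtain ⟨s, hs, hsc⟩ := key π hπx hπz
  have hsx : s ≠ x := fun h => hx (h ▸ hs)
  have hsz : s ≠ z := fun h => hzS (h ▸ hs)
  -- rerouting `s` to a vertex `b` moves the conflict away from `s`, and it cannot move elsewhere
  -- because the colors at `S` are pairwise different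
  obtain ⟨b, hb⟩ := exists_notMem_of_card_lt ({π s, y, z} : Finset α)
    (Finset.card_le_three.trans_lt (by omega))
  simp only [Finset.mem_insert, Finset.mem_singleton, not_or] at hb
  obtain ⟨hbs, hby, hbz⟩ := hb
  have h1 : y ≠ π s := fun h => hsx (π.injective (hπx.trans h)).symm
  have h2 : z ≠ π s := fun h => hsz (π.injective (hπz.trans h)).symm
  obtain ⟨s', hs', hsc'⟩ := key (swap (π s) b * π)
    (by rw [Perm.mul_apply, hπx, swap_apply_of_ne_of_ne h1 (Ne.symm hby)])
    (by rw [Perm.mul_apply, hπz, swap_apply_of_ne_of_ne h2 (Ne.symm hbz)])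
  obtain ⟨rfl, h, -⟩ := hinj _ hs' _ hs _ _ _ _ (hsc'.trans hsc.symm)
  rw [Perm.mul_apply, swap_apply_left] at h
  exact hbs h

end Pairing

/-! ### Two merged classes whose diagonal is a star coloring -/

/-- The color `a` does not occur on a diagonal edge `(z, z, v)`. -/
def IsOffDiagonal {ι α C : Type*} (d : α → α → (ι → α) → C) (a : C) : Prop :=
  ∀ z v, a ≠ d z z v

open Classical in
/-- The color attached to a triple `(x, y, w)` with `x ∈ S`. If `y ∈ S`, it is the color of that
edge. If `y ∉ S`, the edges `(x, y, w)` and `(y, x, σ ∘ w)` together have at most one color that is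
not on the diagonal, and it is that color if there is one. -/
noncomputable def pairColor {ι α C : Type*} (S : Finset α) (σ : Perm α)
    (d : α → α → (ι → α) → C) (p : α × α × (ι → α)) : C :=
  if p.2.1 ∈ S ∨ IsOffDiagonal d (d p.1 p.2.1 p.2.2) then d p.1 p.2.1 p.2.2
  else d p.2.1 p.1 (σ ∘ p.2.2)

section Pairing

variable {ι α C : Type*} {k : ℕ} {d : α → α → (ι → α) → C}
  {S : Finset α} {c₀ : C} {σ : Perm α}

lemma pairColor_of_mem {x y : α} {w : ι → α} (hy : y ∈ S) : pairColor S σ d (x, y, w) = d x y w :=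
  if_pos (Or.inl hy)

lemma pairColor_of_isOffDiagonal {x y : α} {w : ι → α} (h : IsOffDiagonal d (d x y w)) :
    pairColor S σ d (x, y, w) = d x y w :=
  if_pos (Or.inr h)

lemma pairColor_of_not {x y : α} {w : ι → α} (hy : y ∉ S) (h : ¬ IsOffDiagonal d (d x y w)) :
    pairColor S σ d (x, y, w) = d y x (σ ∘ w) :=
  if_neg (not_or.2 ⟨hy, h⟩)

variable [DecidableEq α] [Fintype α]

/-- Otherwise `(x, y, w)`, the diagonal edges at `S` and a diagonal edge of color `c₀` would form a
rainbow matching. -/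
lemma not_isOffDiagonal_of_notMem (hσ : ∀ a, σ a ≠ a) (hS : S.card + 2 = k)
    (hn : S.card + 4 ≤ Fintype.card α)
    (hd : ¬ HasRainbowPairing k d) (hdiag : ∀ z ∉ S, ∀ w, d z z w = c₀)
    (hinj : ∀ x ∈ S, ∀ x' ∈ S, ∀ w w', d x x w = d x' x' w' → x = x' ∧ w = w')
    (hne : ∀ x ∈ S, ∀ w, d x x w ≠ c₀) {x y : α} (hx : x ∉ S) (hy : y ∉ S) (w : ι → α) :
    ¬ IsOffDiagonal d (d x y w) := by
  intro hnew
  have hxy : x ≠ y := by rintro rfl; exact hnew x w rfl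
  obtain ⟨z, hz⟩ := exists_notMem_of_card_lt (insert x (insert y S))
    ((Finset.card_insert_le _ _).trans_lt
      ((Nat.succ_le_succ (Finset.card_insert_le _ _)).trans_lt (by omega)))
  simp only [Finset.mem_insert, not_or] at hz
  obtain ⟨hzx, hzy, hzS⟩ := hz
  obtain ⟨ω, hω, hωx, -⟩ := exists_disjoint_family hxy w (σ ∘ w) (fun i => (hσ _).symm)
  have hfix : ∀ s ∈ S, swap x y s = s := fun s hs =>
    swap_apply_of_ne_of_ne (fun h => hx (h ▸ hs)) (fun h => hy (h ▸ hs))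
  refine false_of_injOn_insert hS hd hdiag hω hx hzS hzx
    (π := swap x y) (swap_apply_of_ne_of_ne hzx hzy) ?_ ?_
  · rw [Finset.coe_insert, Set.injOn_insert (by exact_mod_cast hx)]
    refine ⟨fun a ha b hb hab => ?_, ?_⟩
    · simp only [hfix a ha, hfix b hb] at hab
      exact (hinj a ha b hb _ _ hab).1
    · rintro ⟨a, ha, hax⟩
      simp only [hfix a ha, swap_apply_left, hωx] at hax
      exact hnew _ _ hax.symm
  · intro a ha
    rcases Finset.mem_insert.1 ha with rfl | ha
    · rw [swap_apply_left, hωx, ← hdiag z hzS w]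
      exact hnew _ _
    · rw [hfix a ha]
      exact hne a ha _

/-- Otherwise the disjoint edges `(x, y, w)` and `(y, x, σ ∘ w)` would form a rainbow matching with
the diagonal edges at `S \ {x}` and a diagonal edge of color `c₀`. -/
lemma eq_of_isOffDiagonal (hσ : ∀ a, σ a ≠ a) (hS : S.card + 2 = k)
    (hn : S.card + 4 ≤ Fintype.card α)
    (hd : ¬ HasRainbowPairing k d) (hdiag : ∀ z ∉ S, ∀ w, d z z w = c₀)
    (hinj : ∀ x ∈ S, ∀ x' ∈ S, ∀ w w', d x x w = d x' x' w' → x = x' ∧ w = w')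
    (hne : ∀ x ∈ S, ∀ w, d x x w ≠ c₀) {x y : α} (hx : x ∈ S) (hy : y ∉ S) {w : ι → α}
    (h : IsOffDiagonal d (d x y w)) (h' : IsOffDiagonal d (d y x (σ ∘ w))) :
    d x y w = d y x (σ ∘ w) := by
  by_contra hcol
  have hxy : x ≠ y := by rintro rfl; exact hy hx
  obtain ⟨z, hz⟩ := exists_notMem_of_card_lt (insert y S)
    ((Finset.card_insert_le _ _).trans_lt (by omega))
  simp only [Finset.mem_insert, not_or] at hz
  obtain ⟨hzy, hzS⟩ := hz
  have hzx : z ≠ x := fun h => hzS (h ▸ hx)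
  obtain ⟨ω, hω, hωx, hωy⟩ := exists_disjoint_family hxy w (σ ∘ w) (fun i => (hσ _).symm)
  have hfix : ∀ s ∈ S, s ≠ x → swap x y s = s := fun s hs hsx =>
    swap_apply_of_ne_of_ne hsx (fun h => hy (h ▸ hs))
  refine false_of_injOn_insert hS hd hdiag hω hy hzS hzy
    (π := swap x y) (swap_apply_of_ne_of_ne hzx hzy) ?_ ?_
  · rw [Finset.coe_insert, Set.injOn_insert (by exact_mod_cast hy)]
    refine ⟨fun a ha b hb hab => ?_, ?_⟩
    · by_cases hax : a = x <;> by_cases hbx : b = x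
      · rw [hax, hbx]
      · subst hax
        simp only [hfix b hb hbx, swap_apply_left, hωx] at hab
        exact (h _ _ hab).elim
      · subst hbx
        simp only [hfix a ha hax, swap_apply_left, hωx] at hab
        exact (h _ _ hab.symm).elim
      · simp only [hfix a ha hax, hfix b hb hbx] at hab
        exact (hinj a ha b hb _ _ hab).1
    · rintro ⟨a, ha, hay⟩
      by_cases hax : a = x
      · subst hax
        simp only [swap_apply_left, swap_apply_right, hωx, hωy] at hay
        exact hcol hay
      · simp only [hfix a ha hax, swap_apply_right, hωy] at hay
        exact h' _ _ hay.symm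
  · intro a ha
    rcases Finset.mem_insert.1 ha with rfl | ha
    · rw [swap_apply_right, hωy, ← hdiag z hzS w]
      exact h' _ _
    · by_cases hax : a = x
      · subst hax
        rw [swap_apply_left, hωx, ← hdiag z hzS w]
        exact h _ _
      · rw [hfix a ha hax]
        exact hne a ha _

lemma range_subset_insert_pairColor (hσ : ∀ a, σ a ≠ a) (hS : S.card + 2 = k)
    (hn : S.card + 4 ≤ Fintype.card α)
    (hd : ¬ HasRainbowPairing k d) (hdiag : ∀ z ∉ S, ∀ w, d z z w = c₀)
    (hinj : ∀ x ∈ S, ∀ x' ∈ S, ∀ w w', d x x w = d x' x' w' → x = x' ∧ w = w')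
    (hne : ∀ x ∈ S, ∀ w, d x x w ≠ c₀) :
    (Set.range fun p : α × α × (ι → α) => d p.1 p.2.1 p.2.2) ⊆
      insert c₀ (pairColor S σ d '' {p | p.1 ∈ S}) := by
  rintro _ ⟨⟨x, y, w⟩, rfl⟩
  dsimp only
  by_cases hnew : IsOffDiagonal d (d x y w)
  · by_cases hx : x ∈ S
    · exact Or.inr ⟨(x, y, w), hx, pairColor_of_isOffDiagonal hnew⟩
    · by_cases hy : y ∈ S
      · refine Or.inr ⟨(y, x, σ.symm ∘ w), hy, ?_⟩
        have hw : σ ∘ (σ.symm ∘ w) = w := by ext; simp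
        by_cases h : IsOffDiagonal d (d y x (σ.symm ∘ w))
        · rw [pairColor_of_isOffDiagonal h,
            eq_of_isOffDiagonal hσ hS hn hd hdiag hinj hne hy hx h (by rwa [hw]), hw]
        · rw [pairColor_of_not hx h, hw]
      · exact (not_isOffDiagonal_of_notMem hσ hS hn hd hdiag hinj hne hx hy w hnew).elim
  · simp only [IsOffDiagonal, not_forall, not_not] at hnew
    obtain ⟨z, v, h⟩ := hnew
    rw [h]
    by_cases hz : z ∈ S
    · exact Or.inr ⟨(z, z, v), hz, pairColor_of_mem hz⟩
    · exact Or.inl (hdiag z hz v)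

lemma injOn_pairColor [Fintype ι] (hσ : ∀ a, σ a ≠ a) (hS : S.card + 2 = k)
    (hn : S.card + 4 ≤ Fintype.card α)
    (hd : ¬ HasRainbowPairing k d) (hdiag : ∀ z ∉ S, ∀ w, d z z w = c₀)
    (hinj : ∀ x ∈ S, ∀ x' ∈ S, ∀ w w', d x x w = d x' x' w' → x = x' ∧ w = w')
    (hne : ∀ x ∈ S, ∀ w, d x x w ≠ c₀)
    (hcard : S.card * Fintype.card α ^ (Fintype.card ι + 1) + 1 ≤
      (Set.range fun p : α × α × (ι → α) => d p.1 p.2.1 p.2.2).ncard) :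
    Set.InjOn (pairColor S σ d) {p | p.1 ∈ S} ∧ ∀ p, p.1 ∈ S → pairColor S σ d p ≠ c₀ := by
  classical
  have hT : {p : α × α × (ι → α) | p.1 ∈ S}.ncard =
      S.card * Fintype.card α ^ (Fintype.card ι + 1) := by
    have : {p : α × α × (ι → α) | p.1 ∈ S} =
        ((S ×ˢ (Finset.univ : Finset (α × (ι → α))) : Finset _) : Set _) := by
      ext; simp
    rw [this, Set.ncard_coe_finset, Finset.card_product, Finset.card_univ, Fintype.card_prod,
      Fintype.card_fun, pow_succ']
  exact injOn_of_subset_insert_image (Set.toFinite _)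
    (range_subset_insert_pairColor hσ hS hn hd hdiag hinj hne) (by rwa [hT])

/-- Colors outside the diagonal cannot occur both on an edge `(x, y, w)` from `S` to its complement
and on a disjoint edge `(y', x', w')` in the opposite direction. The rainbow matching that would
result uses `(x', x, _)` if `x ≠ x'`, and diagonal edges elsewhere. -/
lemma false_of_isOffDiagonal (hσ : ∀ a, σ a ≠ a) (hS : S.card + 2 = k)
    (hn : S.card + 4 ≤ Fintype.card α)
    (hd : ¬ HasRainbowPairing k d) (hdiag : ∀ z ∉ S, ∀ w, d z z w = c₀)
    (hinj : ∀ x ∈ S, ∀ x' ∈ S, ∀ w w', d x x w = d x' x' w' → x = x' ∧ w = w')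
    (hne : ∀ x ∈ S, ∀ w, d x x w ≠ c₀)
    (hpinj : Set.InjOn (pairColor S σ d) {p | p.1 ∈ S})
    (hpne : ∀ p, p.1 ∈ S → pairColor S σ d p ≠ c₀)
    {x x' y y' : α} {w w' : ι → α} (hx : x ∈ S) (hx' : x' ∈ S) (hy : y ∉ S) (hy' : y' ∉ S)
    (hyy : y ≠ y') (hw : ∀ i, w i ≠ w' i)
    (h : IsOffDiagonal d (d x y w)) (h' : IsOffDiagonal d (d y' x' w')) : False := by
  have hw' : σ ∘ (σ.symm ∘ w') = w' := by ext; simp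
  have hp' : pairColor S σ d (x', y', σ.symm ∘ w') = d y' x' w' := by
    by_cases h'' : IsOffDiagonal d (d x' y' (σ.symm ∘ w'))
    · rw [pairColor_of_isOffDiagonal h'',
        eq_of_isOffDiagonal hσ hS hn hd hdiag hinj hne hx' hy' h'' (by rwa [hw']), hw']
    · rw [pairColor_of_not hy' h'', hw']
  obtain ⟨z, hz⟩ := exists_notMem_of_card_lt (insert y (insert y' S))
    ((Finset.card_insert_le _ _).trans_lt
      ((Nat.succ_le_succ (Finset.card_insert_le _ _)).trans_lt (by omega)))
  simp only [Finset.mem_insert, not_or] at hz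
  obtain ⟨hzy, hzy', hzS⟩ := hz
  have ne : ∀ {s t}, s ∈ S → t ∉ S → s ≠ t := fun hs ht h => ht (h ▸ hs)
  obtain ⟨ω, hω, hωx, hωy⟩ := exists_disjoint_family (ne hx hy') w w' hw
  -- `π` sends `y'` to `x'`, `x` to `y`, `x'` to `x` (if `x' ≠ x`), and `y` to `y'`
  let π : Perm α := swap x x' * swap x y * swap y y'
  have hπy' : π y' = x' := by simp [π, Perm.mul_apply]
  have hπx : π x = y := by
    simp only [π, Perm.mul_apply]
    rw [swap_apply_of_ne_of_ne (ne hx hy) (ne hx hy'), swap_apply_left,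
      swap_apply_of_ne_of_ne (ne hx hy).symm (ne hx' hy).symm]
  have hπS : ∀ s ∈ S, s ≠ x → π s ∈ S := by
    intro s hs hsx
    simp only [π, Perm.mul_apply]
    rw [swap_apply_of_ne_of_ne (ne hs hy) (ne hs hy'), swap_apply_of_ne_of_ne hsx (ne hs hy),
      swap_apply_def]
    split_ifs <;> assumption
  have hπz : π z = z := by
    simp only [π, Perm.mul_apply]
    rw [swap_apply_of_ne_of_ne hzy hzy', swap_apply_of_ne_of_ne (ne hx hzS).symm hzy,
      swap_apply_of_ne_of_ne (ne hx hzS).symm (ne hx' hzS).symm]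
  have hcolS : ∀ s ∈ S, d s (π s) (ω s) = pairColor S σ d (s, π s, ω s) := by
    intro s hs
    by_cases hsx : s = x
    · subst hsx
      rw [hπx, hωx, pairColor_of_isOffDiagonal h]
    · rw [pairColor_of_mem (hπS s hs hsx)]
  refine false_of_injOn_insert hS hd hdiag hω hy' hzS hzy' hπz ?_ ?_
  · rw [Finset.coe_insert, Set.injOn_insert (by exact_mod_cast hy')]
    refine ⟨fun a ha b hb hab => ?_, ?_⟩
    · simp only [hcolS a ha, hcolS b hb] at hab
      exact congrArg Prod.fst (hpinj ha hb hab)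
    · rintro ⟨a, ha, hay⟩
      simp only [hcolS a ha, hπy', hωy, ← hp'] at hay
      have hay := congrArg (fun p => p.2.1) (hpinj ha hx' hay)
      dsimp only at hay
      by_cases hax : a = x
      · rw [hax, hπx] at hay
        exact hyy hay
      · exact ne (hπS a ha hax) hy' hay
  · intro a ha
    rcases Finset.mem_insert.1 ha with rfl | ha
    · rw [hπy', hωy, ← hp']
      exact hpne _ hx'
    · rw [hcolS a ha]
      exact hpne _ ha

/-- If the diagonal is a star coloring with set `S`, and `d` has more than `|S| * n ^ (|ι| + 1)`
colors, then `c₀` is the color of all edges avoiding `S` in the first class, or of all edges avoiding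
`S` in the second class. -/
theorem eq_of_notMem_left_or_right [Fintype ι] (hσ : ∀ a, σ a ≠ a) (hS : S.card + 2 = k)
    (hn : S.card + 4 ≤ Fintype.card α)
    (hd : ¬ HasRainbowPairing k d) (hdiag : ∀ z ∉ S, ∀ w, d z z w = c₀)
    (hinj : ∀ x ∈ S, ∀ x' ∈ S, ∀ w w', d x x w = d x' x' w' → x = x' ∧ w = w')
    (hne : ∀ x ∈ S, ∀ w, d x x w ≠ c₀)
    (hcard : S.card * Fintype.card α ^ (Fintype.card ι + 1) + 1 ≤
      (Set.range fun p : α × α × (ι → α) => d p.1 p.2.1 p.2.2).ncard) :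
    (∀ x ∉ S, ∀ y w, d x y w = c₀) ∨ ∀ y ∉ S, ∀ x w, d x y w = c₀ := by
  obtain ⟨hpinj, hpne⟩ := injOn_pairColor hσ hS hn hd hdiag hinj hne hcard
  have ne : ∀ {s t}, s ∈ S → t ∉ S → s ≠ t := fun hs ht h => ht (h ▸ hs)
  have hσw : ∀ w : ι → α, σ ∘ (σ.symm ∘ w) = w := fun w => by ext; simp
  have hoff : ∀ x ∈ S, ∀ y ∉ S, ∀ w, IsOffDiagonal d (pairColor S σ d (x, y, w)) := by
    intro x hx y hy w z v h
    by_cases hz : z ∈ S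
    · rw [← pairColor_of_mem (σ := σ) (d := d) (x := z) hz] at h
      have h := hpinj hx hz h
      simp only [Prod.mk.injEq] at h
      exact ne hz hy h.2.1.symm
    · exact hpne (x, y, w) hx (h.trans (hdiag z hz v))
  have hleft : ∀ x ∈ S, ∀ y ∉ S, ∀ w, ¬ IsOffDiagonal d (d x y w) →
      IsOffDiagonal d (d y x (σ ∘ w)) := by
    intro x hx y hy w h
    rw [← pairColor_of_not (S := S) hy h]
    exact hoff x hx y hy w
  by_cases hall : ∀ x ∈ S, ∀ y ∉ S, ∀ w, IsOffDiagonal d (d x y w)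
  · left
    have hcol : ∀ x ∈ S, ∀ y w, d x y w = pairColor S σ d (x, y, w) := by
      intro x hx y w
      by_cases hy : y ∈ S
      · rw [pairColor_of_mem hy]
      · rw [pairColor_of_isOffDiagonal (hall x hx y hy w)]
    intro x hx y w
    refine eq_of_notMem_of_injective hS hn hd hdiag ?_ ?_ hx y w
    · intro x hx x' hx' y y' w w' h
      rw [hcol x hx, hcol x' hx'] at h
      simpa using hpinj hx hx' h
    · intro x hx y w
      rw [hcol x hx]
      exact hpne _ hx
  · right
    push Not at hall
    obtain ⟨x₀, hx₀, y₀, hy₀, w₀, h₀⟩ := hall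
    -- once some `(x₀, y₀, w₀)` has a diagonal color, the new color sits on the transposed edge; this
    -- forces the same for every `(x, y, w)` with `y ≠ y₀` and `w` disjoint from `σ ∘ w₀`, and two such
    -- steps reach all triples
    have hstep : ∀ x₀ ∈ S, ∀ y₀ ∉ S, ∀ w₀, ¬ IsOffDiagonal d (d x₀ y₀ w₀) → ∀ x ∈ S, ∀ y ∉ S,
        ∀ w : ι → α, y ≠ y₀ → (∀ i, w i ≠ σ (w₀ i)) → ¬ IsOffDiagonal d (d x y w) :=
      fun x₀ hx₀ y₀ hy₀ w₀ h₀ x hx y hy w hyy hw h =>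
        false_of_isOffDiagonal hσ hS hn hd hdiag hinj hne hpinj hpne hx hx₀ hy hy₀ hyy hw h
          (hleft x₀ hx₀ y₀ hy₀ w₀ h₀)
    have hnone : ∀ x ∈ S, ∀ y ∉ S, ∀ w, ¬ IsOffDiagonal d (d x y w) := by
      intro x hx y hy w
      obtain ⟨y₁, hy₁⟩ := exists_notMem_of_card_lt (insert y (insert y₀ S))
        ((Finset.card_insert_le _ _).trans_lt
          ((Nat.succ_le_succ (Finset.card_insert_le _ _)).trans_lt (by omega)))
      simp only [Finset.mem_insert, not_or] at hy₁
      have hw₁ : ∀ i, ∃ a, a ∉ ({σ (w₀ i), σ.symm (w i)} : Finset α) := fun i =>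
        exists_notMem_of_card_lt _ (Finset.card_le_two.trans_lt (by omega))
      choose w₁ hw₁ using hw₁
      simp only [Finset.mem_insert, Finset.mem_singleton, not_or] at hw₁
      refine hstep x hx y₁ hy₁.2.2 w₁
        (hstep x₀ hx₀ y₀ hy₀ w₀ h₀ x hx y₁ hy₁.2.2 w₁ hy₁.2.1 fun i => (hw₁ i).1)
        x hx y hy w (Ne.symm hy₁.1) fun i hi => (hw₁ i).2 ?_
      rw [hi, symm_apply_apply]
    have hcol : ∀ x ∈ S, ∀ y ∉ S, ∀ w, d y x w = pairColor S σ d (x, y, σ.symm ∘ w) := by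
      intro x hx y hy w
      rw [pairColor_of_not hy (hnone x hx y hy _), hσw]
    have hcolS : ∀ x ∈ S, ∀ y w, d y x w = pairColor S σ d (y, x, w) :=
      fun x hx y w => (pairColor_of_mem hx).symm
    intro y hy x w
    refine eq_of_notMem_of_injective (d := fun x y w => d y x w) hS hn
      (fun h => hd h.swap) hdiag ?_ ?_ hy x w
    · intro x hx x' hx' y y' w w' h
      by_cases hy : y ∈ S <;> by_cases hy' : y' ∈ S
      · rw [hcolS x hx, hcolS x' hx'] at h
        have h := hpinj hy hy' h
        simp only [Prod.mk.injEq] at h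
        exact ⟨h.2.1, h.1, h.2.2⟩
      · rw [hcolS x hx, hcol x' hx' y' hy'] at h
        have h := hpinj hy hx' h
        simp only [Prod.mk.injEq] at h
        exact (ne hx hy' h.2.1).elim
      · rw [hcolS x' hx', hcol x hx y hy] at h
        have h := hpinj hx hy' h
        simp only [Prod.mk.injEq] at h
        exact (ne hx' hy h.2.1.symm).elim
      · rw [hcol x hx y hy, hcol x' hx' y' hy'] at h
        have h := hpinj hx hx' h
        simp only [Prod.mk.injEq] at h
        refine ⟨h.1, h.2.1, ?_⟩
        rw [← hσw w, ← hσw w', h.2.2]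
    · intro x hx y w
      by_cases hy : y ∈ S
      · rw [hcolS x hx]
        exact hpne _ hy
      · rw [hcol x hx y hy]
        exact hpne _ hx

end Pairing

/-! ### From a merged coloring to the whole coloring -/

/-- The edges that meet the subset `S` of the `i`-th class have pairwise different colors, and all
the other edges have one further color `c₀`. -/
structure IsStarColoring {ι α C : Type*} (i : ι) (S : Finset α) (c₀ : C) (c : (ι → α) → C) :
    Prop where
  injOn : Set.InjOn c {e | e i ∈ S}
  ne : ∀ e, e i ∈ S → c e ≠ c₀
  eq : ∀ e, e i ∉ S → c e = c₀

lemma ncard_setOf_apply_mem {α : Type*} [Fintype α] [DecidableEq α] {m : ℕ} (i : Fin (m + 1))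
    (S : Finset α) : {e : Fin (m + 1) → α | e i ∈ S}.ncard = S.card * Fintype.card α ^ m := by
  have : {e : Fin (m + 1) → α | e i ∈ S} =
      (Fintype.piFinset (Function.update (fun _ => Finset.univ) i S) :
        Finset (Fin (m + 1) → α)) := by
    ext e
    simp only [Set.mem_ofPred_eq, Finset.mem_coe, Fintype.mem_piFinset]
    constructor
    · intro h j
      by_cases hj : j = i
      · subst hj; simpa
      · simp [hj]
    · intro h
      simpa using h i
  rw [this, Set.ncard_coe_finset, Fintype.card_piFinset, Fin.prod_univ_succAbove _ i]
  simp

/-- A coloring that is constant on the edges avoiding `S` and has the maximal number of colors is a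
star coloring. -/
lemma isStarColoring_of_card_le {α C : Type*} [Fintype α] [DecidableEq α] {m : ℕ}
    {c : (Fin (m + 1) → α) → C} {i : Fin (m + 1)} {S : Finset α} {c₀ : C}
    (h : ∀ e, e i ∉ S → c e = c₀)
    (hcard : S.card * Fintype.card α ^ m + 1 ≤ (Set.range c).ncard) :
    IsStarColoring i S c₀ c := by
  have hsub : Set.range c ⊆ insert c₀ (c '' {e | e i ∈ S}) := by
    rintro _ ⟨e, rfl⟩
    by_cases he : e i ∈ S
    · exact Or.inr ⟨e, he, rfl⟩
    · exact Or.inl (h e he)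
  obtain ⟨hinj, hne⟩ := injOn_of_subset_insert_image (Set.toFinite _) hsub
    (by rwa [ncard_setOf_apply_mem])
  exact ⟨hinj, hne, h⟩

lemma HasRainbowPairing.hasRainbowFamily {α C : Type*} {m k : ℕ} {c : (Fin (m + 2) → α) → C}
    (h : HasRainbowPairing k fun x y w => c (Fin.cons x (Fin.cons y w))) :
    HasRainbowFamily k c := by
  obtain ⟨X, π, ω, hX, hω, hinj⟩ := h
  refine ⟨X, fun a => Fin.cons a (Fin.cons (π a) (ω a)), hX, fun a _ b _ hab => ?_, hinj⟩
  refine Fin.cases (by simpa using hab) (Fin.cases (by simpa using hab) fun i => ?_)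
  simpa using hω a b hab i

lemma HasRainbowFamily.of_merge {α C : Type*} {m k : ℕ} {c : (Fin (m + 2) → α) → C}
    (h : HasRainbowFamily k fun g : Fin (m + 1) → α => c (Fin.cons (g 0) g)) :
    HasRainbowFamily k c := by
  obtain ⟨X, u, hX, hu, hinj⟩ := h
  refine ⟨X, fun a => Fin.cons (u a 0) (u a), hX, fun a ha b hb hab => ?_, hinj⟩
  exact Fin.cases (by simpa using hu a ha b hb hab 0) (by simpa using hu a ha b hb hab)

/-- Classes `0` and `1` are merged by restricting `c` to the edges `Fin.cons (g 0) g`. If the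
restriction is a star coloring whose set `S` lies in a class other than the merged one, then every
edge avoiding `S` has color `c₀`. -/
lemma eq_of_notMem_of_merge_ne_zero {α C : Type*} [Fintype α] [DecidableEq α] {m k : ℕ}
    {c : (Fin (m + 2) → α) → C} {S : Finset α} {c₀ : C} (hS : S.card + 2 = k)
    (hn : S.card + 4 ≤ Fintype.card α) (hc : ¬ HasRainbowFamily k c) {i : Fin (m + 1)} (hi : i ≠ 0)
    (hstar : IsStarColoring i S c₀ fun g : Fin (m + 1) → α => c (Fin.cons (g 0) g))
    (e : Fin (m + 2) → α) (he : e i.succ ∉ S) : c e = c₀ := by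
  by_contra hce
  set y := e i.succ with hy
  obtain ⟨z, hz⟩ := exists_notMem_of_card_lt (insert y S)
    ((Finset.card_insert_le _ _).trans_lt (by omega))
  simp only [Finset.mem_insert, not_or] at hz
  obtain ⟨hzy, hzS⟩ := hz
  -- the matching consists of `e` and the edges of the piece that the permutations `q` attach to the
  -- vertices of `insert z S` in class `i`; the merged vertices of these are given by `q 0`, which has
  -- to avoid both `e 0` and `e 1 = q 0 y`
  have key : ∀ q : Fin (m + 1) → Perm α, q i = 1 → (∀ j, q j y = e j.succ) →
      (∀ a ∈ insert z S, q 0 a ≠ e 0) →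
      ∃ s ∈ S, c (Fin.cons (q 0 s) fun j => q j s) = c e := by
    intro q hqi hqy hq0
    by_contra! hs
    have hcz : c (Fin.cons (q 0 z) fun j => q j z) = c₀ :=
      hstar.eq (fun j => q j z) (by simpa [hqi] using hzS)
    let u : α → Fin (m + 2) → α := fun a =>
      Fin.cons (if a = y then e 0 else q 0 a) fun j => q j a
    have huy : u y = e := by
      refine funext (Fin.cases ?_ fun j => ?_)
      · simp [u]
      · simp [u, hqy]
    have hu : ∀ a, a ≠ y → u a = Fin.cons (q 0 a) fun j => q j a := fun a ha => by
      simp [u, ha]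
    have hS' : ∀ a ∈ S, a ≠ y := fun a ha h => he (h ▸ ha)
    have hyS : y ∉ insert z S := by simp [he, Ne.symm hzy]
    refine hc ⟨insert y (insert z S), u, ?_, ?_, ?_⟩
    · rw [Finset.card_insert_of_notMem hyS, Finset.card_insert_of_notMem hzS, ← hS]
    · intro a ha b hb hab
      refine Fin.cases ?_ fun j => ?_
      · rcases Finset.mem_insert.1 ha with rfl | ha' <;> rcases Finset.mem_insert.1 hb with rfl | hb'
        · exact (hab rfl).elim
        · simpa [u, Ne.symm hab] using (hq0 b hb').symm
        · simpa [u, hab] using hq0 a ha'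
        · have h1 : a ≠ y := fun h => hyS (h ▸ ha')
          have h2 : b ≠ y := fun h => hyS (h ▸ hb')
          simpa [u, h1, h2] using hab
      · simpa [u] using hab
    · rw [Finset.coe_insert, Set.injOn_insert (by exact_mod_cast hyS), Finset.coe_insert,
        Set.injOn_insert (by exact_mod_cast hzS)]
      refine ⟨⟨fun a ha b hb hab => ?_, ?_⟩, ?_⟩
      · simp only [hu a (hS' a ha), hu b (hS' b hb)] at hab
        have := hstar.injOn (x₁ := fun j => q j a) (x₂ := fun j => q j b)
          (by simpa [hqi] using ha) (by simpa [hqi] using hb) hab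
        simpa [hqi] using congrFun this i
      · rintro ⟨a, ha, haz⟩
        simp only [hu a (hS' a ha), hu z hzy, hcz] at haz
        exact hstar.ne (fun j => q j a) (by simpa [hqi] using ha) haz
      · rintro ⟨a, ha, hay⟩
        simp only [huy] at hay
        rcases ha with rfl | ha
        · rw [hu a hzy, hcz] at hay
          exact hce hay.symm
        · rw [hu a (hS' a ha)] at hay
          exact hs a ha hay
  obtain ⟨ρ, hρy, hρ0⟩ : ∃ ρ : Perm α, ρ y = e 1 ∧ ∀ a ∈ insert z S, ρ a ≠ e 0 := by
    by_cases h01 : e 0 = e 1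
    · refine ⟨swap y (e 1), swap_apply_left _ _, fun a ha h => ?_⟩
      rw [h01, swap_apply_eq_iff, swap_apply_right] at h
      subst h
      simp [he, Ne.symm hzy] at ha
    · obtain ⟨v, hv⟩ := exists_notMem_of_card_lt (insert y (insert z S))
        ((Finset.card_insert_le _ _).trans_lt
          ((Nat.succ_le_succ (Finset.card_insert_le _ _)).trans_lt (by omega)))
      rw [Finset.mem_insert, not_or] at hv
      obtain ⟨ρ, hρy, hρv⟩ := exists_perm_apply_eq (Ne.symm hv.1) (Ne.symm h01)
      refine ⟨ρ, hρy, fun a ha h => hv.2 ?_⟩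
      rwa [← ρ.injective (h.trans hρv.symm)]
  have hq : ∀ ρ : Perm α, ρ y = e 1 → (∀ a ∈ insert z S, ρ a ≠ e 0) → ∃ s ∈ S,
      c (Fin.cons (ρ s) (Function.update (fun j => swap y (e j.succ) s) 0 (ρ s))) = c e := by
    intro ρ hρy hρ0
    obtain ⟨s, hs, h⟩ := key (Function.update (fun j => swap y (e j.succ)) 0 ρ)
      (by rw [Function.update_of_ne hi, ← hy, swap_self]; rfl)
      (fun j => by
        by_cases hj : j = 0
        · subst hj; simpa using hρy
        · simp [hj])
      (by simpa using hρ0)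
    refine ⟨s, hs, ?_⟩
    rw [← h]
    congr 1
    refine funext (Fin.cases (by simp) fun j => ?_)
    by_cases hj : j = 0
    · subst hj; simp
    · simp [hj]
  obtain ⟨s, hs, hsc⟩ := hq ρ hρy hρ0
  -- the only conflict left is at `s`; changing the merged vertex of that edge resolves it
  obtain ⟨b, hb⟩ := exists_notMem_of_card_lt ({ρ s, e 0, e 1} : Finset α)
    (Finset.card_le_three.trans_lt (by omega))
  simp only [Finset.mem_insert, Finset.mem_singleton, not_or] at hb
  obtain ⟨hbs, hb0, hb1⟩ := hb
  have h0 : e 0 ≠ ρ s := (hρ0 s (Finset.mem_insert_of_mem hs)).symm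
  have h1 : e 1 ≠ ρ s := fun h => he (ρ.injective (hρy.trans h) ▸ hs)
  obtain ⟨s', hs', hsc'⟩ := hq (swap (ρ s) b * ρ)
    (by rw [Perm.mul_apply, hρy, swap_apply_of_ne_of_ne h1 (Ne.symm hb1)])
    (fun a ha h => hρ0 a ha (by
      rwa [Perm.mul_apply, swap_apply_eq_iff, swap_apply_of_ne_of_ne h0 (Ne.symm hb0)] at h))
  have hmem : ∀ (ρ : Perm α) (s : α), s ∈ S →
      Function.update (fun j : Fin (m + 1) => swap y (e j.succ) s) 0 (ρ s) i ∈ S := by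
    intro ρ s hs
    rwa [Function.update_of_ne hi, ← hy, swap_self]
  have h := hstar.injOn (hmem (swap (ρ s) b * ρ) s' hs') (hmem ρ s hs)
    (by simp only [Function.update_self]; exact hsc'.trans hsc.symm)
  have hss : s' = s := by
    have := congrFun h i
    rwa [Function.update_of_ne hi, Function.update_of_ne hi, ← hy, swap_self] at this
  have := congrFun h 0
  simp [hss] at this
  exact hbs this

/-- If the coloring obtained by merging the classes `0` and `1` is a star coloring with set `S`, and
`c` has the maximal number of colors, then all edges avoiding `S` in some class have color `c₀`. -/
theorem exists_eq_of_notMem_of_merge {α C : Type*} [AddCommGroup α] [Fintype α] [DecidableEq α]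
    {m k : ℕ} {c : (Fin (m + 2) → α) → C} {S : Finset α} {c₀ : C} (hS : S.card + 2 = k)
    (hn : S.card + 4 ≤ Fintype.card α) (hc : ¬ HasRainbowFamily k c) {i : Fin (m + 1)}
    (hstar : IsStarColoring i S c₀ fun g : Fin (m + 1) → α => c (Fin.cons (g 0) g))
    (hcard : S.card * Fintype.card α ^ (m + 1) + 1 ≤ (Set.range c).ncard) :
    ∃ i, ∀ e, e i ∉ S → c e = c₀ := by
  by_cases hi : i = 0
  · subst hi
    have : Nontrivial α := Fintype.one_lt_card_iff_nontrivial.1 (by omega)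
    obtain ⟨t, ht⟩ := exists_ne (0 : α)
    have hσ : ∀ a, Equiv.addRight t a ≠ a := by simpa using ht
    have hcons : ∀ e : Fin (m + 2) → α,
        e = Fin.cons (e 0) (Fin.cons (e 1) fun j => e j.succ.succ) := fun e =>
      funext (Fin.cases rfl (Fin.cases rfl fun j => by simp))
    have hrange : (Set.range fun p : α × α × (Fin m → α) =>
        c (Fin.cons p.1 (Fin.cons p.2.1 p.2.2))) = Set.range c := by
      ext a
      constructor
      · rintro ⟨p, rfl⟩
        exact ⟨_, rfl⟩
      · rintro ⟨e, rfl⟩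
        refine ⟨(e 0, e 1, fun j => e j.succ.succ), ?_⟩
        exact congrArg c (hcons e).symm
    have h := eq_of_notMem_left_or_right (d := fun x y w => c (Fin.cons x (Fin.cons y w)))
      (c₀ := c₀) hσ hS hn (fun h => hc h.hasRainbowFamily)
      (fun z hz w => hstar.eq (Fin.cons z w) hz)
      (fun x hx x' hx' w w' h => by
        have := hstar.injOn (x₁ := Fin.cons x w) (x₂ := Fin.cons x' w') hx hx' h
        exact Fin.cons_inj.1 this)
      (fun x hx w => hstar.ne (Fin.cons x w) hx)
      (by rw [hrange, Fintype.card_fin]; exact hcard)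
    rcases h with h | h
    · exact ⟨0, fun e he => by rw [hcons e]; exact h _ he _ _⟩
    · exact ⟨1, fun e he => by rw [hcons e]; exact h _ he _ _⟩
  · exact ⟨i.succ, eq_of_notMem_of_merge_ne_zero hS hn hc hi hstar⟩

/-! ### The square: a diagonal with many colors -/

section Square

variable {α C : Type*} [Fintype α] [DecidableEq α] [DecidableEq C] {k : ℕ} {d : α → α → C}

/-- If the color of `(x, y)` is not on the diagonal, then swapping `x` and `y` in the diagonal must
lose a diagonal color, so some diagonal color occurs only at `x` and `y`. -/
lemma exists_unique_fiber_of_forall_ne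
    (hd : ∀ π : Perm α, (Finset.univ.image fun x => d x (π x)).card + 1 ≤ k)
    (hdiag : k ≤ (Finset.univ.image fun x => d x x).card + 1) {x y : α}
    (hxy : ∀ z, d x y ≠ d z z) :
    ∃ z, ∀ z', d z' z' = d z z → z' = x ∨ z' = y := by
  by_contra! h
  have hsub : insert (d x y) (Finset.univ.image fun x => d x x) ⊆
      Finset.univ.image fun z => d z (swap x y z) := by
    intro a ha
    simp only [Finset.mem_insert, Finset.mem_image, Finset.mem_univ, true_and] at ha ⊢
    rcases ha with rfl | ⟨z, rfl⟩
    · exact ⟨x, by rw [swap_apply_left]⟩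
    · obtain ⟨z', hz', h1, h2⟩ := h z
      exact ⟨z', by rw [swap_apply_of_ne_of_ne h1 h2, hz']⟩
  have h1 := Finset.card_le_card hsub
  rw [Finset.card_insert_of_notMem (by simpa using fun z => (hxy z).symm)] at h1
  have := hd (swap x y)
  omega

/-- If swapping `x` and `y` in the diagonal loses at most the color `b`, then it gains at most one
color. -/
lemma eq_swap_of_forall_ne
    (hd : ∀ π : Perm α, (Finset.univ.image fun x => d x (π x)).card + 1 ≤ k)
    (hdiag : k ≤ (Finset.univ.image fun x => d x x).card + 1) {x y : α} {b : C}
    (hb : ∀ z, d z z ≠ b → ∃ z', z' ≠ x ∧ z' ≠ y ∧ d z' z' = d z z)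
    (hxy : ∀ z, d x y ≠ d z z) (hyx : ∀ z, d y x ≠ d z z) : d x y = d y x := by
  by_contra hne
  have hsub : insert (d x y) (insert (d y x) ((Finset.univ.image fun x => d x x).erase b)) ⊆
      Finset.univ.image fun z => d z (swap x y z) := by
    intro a ha
    simp only [Finset.mem_insert, Finset.mem_erase, Finset.mem_image, Finset.mem_univ,
      true_and] at ha ⊢
    rcases ha with rfl | rfl | ⟨hab, z, rfl⟩
    · exact ⟨x, by rw [swap_apply_left]⟩
    · exact ⟨y, by rw [swap_apply_right]⟩
    · obtain ⟨z', h1, h2, hz'⟩ := hb z hab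
      exact ⟨z', by rw [swap_apply_of_ne_of_ne h1 h2, hz']⟩
  have h1 := Finset.card_le_card hsub
  rw [Finset.card_insert_of_notMem (by simpa [hne] using fun _ z => (hxy z).symm),
    Finset.card_insert_of_notMem (by simpa using fun _ z => (hyx z).symm)] at h1
  have := hd (swap x y)
  have := Finset.pred_card_le_card_erase (s := Finset.univ.image fun x => d x x) (a := b)
  omega

/-- If no permutation of the square has `k` colors, the diagonal has `k - 1` colors and the square
has more than `(k - 2) * n` colors, then `k - 2` of the diagonal colors occur once on the diagonal and
the rest of the diagonal has one color. -/
lemma exists_diagonal_star (hk : k + 2 ≤ Fintype.card α) (hk2 : 2 ≤ k)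
    (hd : ∀ π : Perm α, (Finset.univ.image fun x => d x (π x)).card + 1 ≤ k)
    (hdiag : k ≤ (Finset.univ.image fun x => d x x).card + 1)
    (hcard : (k - 2) * Fintype.card α + 1 ≤
      (Finset.univ.image fun p : α × α => d p.1 p.2).card) :
    ∃ (S : Finset α) (c₀ : C), S.card + 2 = k ∧ (∀ x ∈ S, ∀ y, d y y = d x x → y = x) ∧
      ∀ x ∉ S, d x x = c₀ := by
  let S : Finset α := Finset.univ.filter fun x => ∀ y, d y y = d x x → y = x
  have hS : ∀ x, x ∈ S ↔ ∀ y, d y y = d x x → y = x := fun x => by simp [S]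
  have hS' : ∀ x ∉ S, ∃ y, d y y = d x x ∧ y ≠ x := fun x hx => by
    rw [hS] at hx; push Not at hx; exact hx
  -- `S` is where the diagonal color occurs once, `B` is the set of the other diagonal colors
  let B : Finset C := Sᶜ.image fun x => d x x
  have hB : ∀ x ∉ S, d x x ∈ B := fun x hx =>
    Finset.mem_image_of_mem (fun x => d x x) (Finset.mem_compl.2 hx)
  have hAB : S.card + B.card + 1 = k := by
    have h1 : (Finset.univ.image fun x => d x x) = (S.image fun x => d x x) ∪ B := by
      rw [← Finset.image_union, Finset.union_compl]
    have h2 : Disjoint (S.image fun x => d x x) B := by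
      rw [Finset.disjoint_left]
      intro a ha hb
      simp only [B, Finset.mem_image, Finset.mem_compl] at ha hb
      obtain ⟨x, hx, rfl⟩ := ha
      obtain ⟨y, hy, hyx⟩ := hb
      exact hy ((hS x).1 hx y hyx ▸ hx)
    have h3 : (S.image fun x => d x x).card = S.card :=
      Finset.card_image_of_injOn fun x _ y hy h => (hS y).1 hy x h
    have h4 := congrArg Finset.card h1
    rw [Finset.card_union_of_disjoint h2, h3] at h4
    have h5 := hd 1
    simp only [Perm.one_apply] at h5
    omega
  have hB0 : B.card ≠ 0 := by
    intro h
    have : S.card < Fintype.card α := by omega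
    obtain ⟨z, hz⟩ := exists_notMem_of_card_lt S this
    rw [Finset.card_eq_zero] at h
    have := hB z hz
    simp [h] at this
  -- outside `S`, a new color at `(x, y)` forces `x` and `y` to be the two occurrences of one diagonal
  -- color; so each color in `B` accounts for at most one new color
  have hfiber : ∀ x ∉ S, ∀ y ∉ S, (∀ z, d x y ≠ d z z) →
      d y y = d x x ∧ ∀ z, d z z = d x x → z = x ∨ z = y := by
    intro x hx y hy hxy
    obtain ⟨z, hz⟩ := exists_unique_fiber_of_forall_ne hd hdiag hxy
    rcases hz z rfl with rfl | rfl
    · obtain ⟨y', hy', hne⟩ := hS' z hx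
      obtain rfl := (hz y' hy').resolve_left hne
      exact ⟨hy', hz⟩
    · obtain ⟨x', hx', hne⟩ := hS' z hy
      obtain rfl := (hz x' hx').resolve_right hne
      exact ⟨hx'.symm, fun z' hz' => hz z' (hz'.trans hx')⟩
  have huniq : ∀ x ∉ S, ∀ y ∉ S, ∀ x' ∉ S, ∀ y' ∉ S, (∀ z, d x y ≠ d z z) →
      (∀ z, d x' y' ≠ d z z) → d x x = d x' x' → d x y = d x' y' := by
    intro x hx y hy x' hx' y' hy' h h' hxx
    obtain ⟨hyx, hf⟩ := hfiber x hx y hy h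
    obtain ⟨hyx', -⟩ := hfiber x' hx' y' hy' h'
    have hne : x' ≠ y' := by rintro rfl; exact h' _ rfl
    have hswap : (∀ z, d y x ≠ d z z) → d x y = d y x :=
      eq_swap_of_forall_ne hd hdiag (b := d x x)
        (fun z hz => ⟨z, by rintro rfl; exact hz rfl, by rintro rfl; exact hz hyx, rfl⟩) h
    rcases hf x' hxx.symm with rfl | rfl <;> rcases hf y' (hyx'.trans hxx.symm) with rfl | rfl
    · exact (hne rfl).elim
    · rfl
    · exact hswap h'
    · exact (hne rfl).elim
  have hswap : ∀ x ∈ S, ∀ y ∉ S, (∀ z, d x y ≠ d z z) → (∀ z, d y x ≠ d z z) →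
      d x y = d y x := by
    intro x hx y hy
    refine eq_swap_of_forall_ne hd hdiag (b := d x x) fun z hz => ?_
    by_cases hzy : z = y
    · subst hzy
      obtain ⟨y', hy', hne⟩ := hS' z hy
      exact ⟨y', by rintro rfl; exact hz hy'.symm, hne, hy'⟩
    · exact ⟨z, by rintro rfl; exact hz rfl, hzy, rfl⟩
  have hB1 : B.card ≤ 1 := by
    by_contra hB2
    obtain ⟨h, hh⟩ : ∃ h : C → C, ∀ x ∉ S, ∀ y ∉ S, (∀ z, d x y ≠ d z z) →
        d x y = h (d x x) := by
      have : ∀ b : C, ∃ a : C, ∀ x ∉ S, ∀ y ∉ S, (∀ z, d x y ≠ d z z) → d x x = b →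
          d x y = a := by
        intro b
        by_cases hex : ∃ x ∉ S, ∃ y ∉ S, (∀ z, d x y ≠ d z z) ∧ d x x = b
        · obtain ⟨x, hx, y, hy, h, rfl⟩ := hex
          exact ⟨d x y, fun x' hx' y' hy' h' hxx =>
            huniq x' hx' y' hy' x hx y hy h' h hxx⟩
        · exact ⟨b, fun x hx y hy h hb => (hex ⟨x, hx, y, hy, h, hb⟩).elim⟩
      choose h hh using this
      exact ⟨h, fun x hx y hy hn => hh _ x hx y hy hn rfl⟩
    classical
    let g : α × α → C := fun p =>
      if p.2 ∈ S ∨ ∀ z, d p.1 p.2 ≠ d z z then d p.1 p.2 else d p.2 p.1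
    have hsub : (Finset.univ.image fun p : α × α => d p.1 p.2) ⊆
        (B ∪ B.image h) ∪ (S ×ˢ Finset.univ).image g := by
      intro a ha
      simp only [Finset.mem_image, Finset.mem_univ, true_and, Prod.exists] at ha
      obtain ⟨x, y, rfl⟩ := ha
      simp only [Finset.mem_union]
      have hg : ∀ p : α × α, p.1 ∈ S → g p ∈ (S ×ˢ Finset.univ).image g := fun p hp =>
        Finset.mem_image_of_mem _ (Finset.mem_product.2 ⟨hp, Finset.mem_univ _⟩)
      by_cases hnew : ∀ z, d x y ≠ d z z
      · by_cases hx : x ∈ S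
        · right
          have : g (x, y) = d x y := if_pos (Or.inr hnew)
          exact this ▸ hg (x, y) hx
        · by_cases hy : y ∈ S
          · right
            have : g (y, x) = d x y := by
              by_cases hyx : ∀ z, d y x ≠ d z z
              · rw [← hswap y hy x hx hyx hnew]
                exact if_pos (Or.inr hyx)
              · exact if_neg (not_or.2 ⟨hx, hyx⟩)
            exact this ▸ hg (y, x) hy
          · left; right
            rw [hh x hx y hy hnew]
            exact Finset.mem_image_of_mem h (hB x hx)
      · push Not at hnew
        obtain ⟨z, hz⟩ := hnew
        rw [hz]
        by_cases hzS : z ∈ S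
        · right
          have : g (z, z) = d z z := if_pos (Or.inl hzS)
          exact this ▸ hg (z, z) hzS
        · exact Or.inl (Or.inl (hB z hzS))
    -- there are at most `|S| * n + 2 * |B|` colors and `|S| + |B| = k - 1`, which is too few if
    -- `|B| ≥ 2`
    have h1 := hcard.trans (Finset.card_le_card hsub)
    have h2 := Finset.card_union_le (B ∪ B.image h) ((S ×ˢ Finset.univ).image g)
    have h3 := Finset.card_union_le B (B.image h)
    have h4 : (B.image h).card ≤ B.card := Finset.card_image_le
    have h5 : ((S ×ˢ (Finset.univ : Finset α)).image g).card ≤ S.card * Fintype.card α := by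
      refine Finset.card_image_le.trans ?_
      rw [Finset.card_product, Finset.card_univ]
    obtain ⟨t, ht⟩ : ∃ t, B.card = t + 2 := ⟨B.card - 2, by omega⟩
    have hk' : k - 2 = S.card + t + 1 := by omega
    rw [hk'] at h1
    have h6 : t * 4 ≤ t * Fintype.card α := Nat.mul_le_mul_left t (by omega)
    have h7 : (S.card + t + 1) * Fintype.card α =
      S.card * Fintype.card α + t * Fintype.card α + Fintype.card α := by ring
    omega
  have hB' : B.card = 1 := by omega
  obtain ⟨c₀, hc₀⟩ := Finset.card_eq_one.1 hB'
  refine ⟨S, c₀, by omega, fun x hx => (hS x).1 hx, fun x hx => ?_⟩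
  have := hB x hx
  rwa [hc₀, Finset.mem_singleton] at this

end Square

/-! ### Induction on the number of classes -/

lemma HasRainbowFamily.of_shift {α C : Type*} [AddCommGroup α] {m k : ℕ}
    {c : (Fin (m + 1) → α) → C} {t : α}
    (h : HasRainbowFamily k fun f : Fin (m + 1) → α => c (Fin.cons (f 0 + t) (Fin.tail f))) :
    HasRainbowFamily k c := by
  obtain ⟨X, u, hX, hu, hinj⟩ := h
  refine ⟨X, fun a => Fin.cons (u a 0 + t) (Fin.tail (u a)), hX, fun a ha b hb hab => ?_, hinj⟩
  exact Fin.cases (by simpa using hu a ha b hb hab 0)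
    (fun j => by simpa [Fin.tail] using hu a ha b hb hab j.succ)

lemma exists_lt_ncard_range_merge {α C : Type*} [AddCommGroup α] [Fintype α] {m q : ℕ}
    (c : (Fin (m + 2) → α) → C)
    (hcard : q * Fintype.card α ^ (m + 1) + 1 ≤ (Set.range c).ncard) :
    ∃ t : α, q * Fintype.card α ^ m + 1 ≤
      (Set.range fun g : Fin (m + 1) → α => c (Fin.cons (g 0 + t) g)).ncard := by
  by_contra! h
  have hU : Set.range c =
      ⋃ t : α, Set.range fun g : Fin (m + 1) → α => c (Fin.cons (g 0 + t) g) := by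
    ext a
    simp only [Set.mem_range, Set.mem_iUnion]
    constructor
    · rintro ⟨e, rfl⟩
      refine ⟨e 0 - e 1, Fin.tail e, ?_⟩
      have : Fin.tail e 0 + (e 0 - e 1) = e 0 := by simp [Fin.tail]
      rw [this, Fin.cons_self_tail]
    · rintro ⟨t, g, rfl⟩
      exact ⟨_, rfl⟩
  have h1 := Set.ncard_iUnion_le_of_fintype
    fun t : α => Set.range fun g : Fin (m + 1) → α => c (Fin.cons (g 0 + t) g)
  have h2 := h1.trans (Finset.sum_le_card_nsmul Finset.univ _ (q * Fintype.card α ^ m)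
    fun t _ => Nat.lt_succ_iff.1 (h t))
  rw [← hU, Finset.card_univ, smul_eq_mul] at h2
  have h3 : Fintype.card α * (q * Fintype.card α ^ m) = q * Fintype.card α ^ (m + 1) := by ring
  omega

lemma exists_isStarColoring_one {α C : Type*} [AddCommGroup α] [Fintype α] [DecidableEq α] {k : ℕ}
    (hk2 : 2 ≤ k) (hk : k + 2 ≤ Fintype.card α) (c : (Fin 2 → α) → C)
    (hc : ¬ HasRainbowFamily k c)
    (hdiag : k ≤ (Set.range fun g : Fin 1 → α => c (Fin.cons (g 0) g)).ncard + 1)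
    (hcard : (k - 2) * Fintype.card α + 1 ≤ (Set.range c).ncard) :
    ∃ (S : Finset α) (c₀ : C), S.card + 2 = k ∧
      IsStarColoring 0 S c₀ fun g : Fin 1 → α => c (Fin.cons (g 0) g) := by
  classical
  have hone : ∀ g : Fin 1 → α, g = ![g 0] := fun g => List.ofFn_inj.mp rfl
  have hmerge : ∀ g : Fin 1 → α, c (Fin.cons (g 0) g) = c ![g 0, g 0] := fun g => by
    rw [hone g]; rfl
  have h1 : (Set.range fun g : Fin 1 → α => c (Fin.cons (g 0) g)) =
      ((Finset.univ.image fun x => c ![x, x] : Finset C) : Set C) := by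
    ext a
    simp only [Finset.coe_image, Finset.coe_univ, Set.image_univ, Set.mem_range]
    constructor
    · rintro ⟨g, rfl⟩
      exact ⟨g 0, (hmerge g).symm⟩
    · rintro ⟨x, rfl⟩
      exact ⟨![x], hmerge _⟩
  have h2 : Set.range c =
      ((Finset.univ.image fun p : α × α => c ![p.1, p.2] : Finset C) : Set C) := by
    ext a
    simp only [Finset.coe_image, Finset.coe_univ, Set.image_univ, Set.mem_range, Prod.exists]
    constructor
    · rintro ⟨e, rfl⟩
      exact ⟨e 0, e 1, congrArg c (List.ofFn_inj.mp rfl)⟩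
    · rintro ⟨x, y, rfl⟩
      exact ⟨_, rfl⟩
  rw [h1, Set.ncard_coe_finset] at hdiag
  rw [h2, Set.ncard_coe_finset] at hcard
  obtain ⟨S, c₀, hS, hinj, heq⟩ := exists_diagonal_star (d := fun x y => c ![x, y]) hk hk2
    (fun π => by
      by_contra! hlt
      obtain ⟨T, hT, hTk⟩ := Finset.exists_subset_card_eq (Nat.lt_succ_iff.1 hlt)
      obtain ⟨X, -, hX, hXT⟩ := Finset.exists_subset_injOn_image_eq_of_surjOn
        (f := fun x => c ![x, π x]) Set.univ T
        fun a ha => by simpa using hT (Finset.mem_coe.1 ha)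
      refine hc ⟨X, fun x => ![x, π x], ?_, fun a _ b _ hab => ?_, hX⟩
      · rw [← hTk, ← hXT, Finset.card_image_of_injOn hX]
      · exact Fin.cases hab (Fin.cases (by simpa using hab) fun j => j.elim0)) hdiag hcard
  have hlt : S.card < Fintype.card α := by omega
  obtain ⟨z, hz⟩ := exists_notMem_of_card_lt S hlt
  refine ⟨S, c₀, hS, fun g hg g' hg' h => ?_, fun g hg h => ?_, fun g hg => ?_⟩
  · rw [hmerge, hmerge] at h
    rw [hone g, hone g', hinj _ hg' _ h]
  · rw [hmerge, ← heq z hz] at h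
    exact hz (hinj _ hg z h.symm ▸ hg)
  · rw [hmerge]
    exact heq _ hg

/-- Reduction to the case in which the merging of the classes `0` and `1` along `e 0 = e 1` has many
colors: some merging `e 0 = e 1 + t` does, and class `0` can be translated by `t`. -/
lemma exists_eq_of_notMem_of_shift {α C : Type*} [AddCommGroup α] [Fintype α] [DecidableEq α]
    {k m : ℕ} (c : (Fin (m + 2) → α) → C) (hc : ¬ HasRainbowFamily k c)
    (hcard : (k - 2) * Fintype.card α ^ (m + 1) + 1 ≤ (Set.range c).ncard)
    (h : ∀ c : (Fin (m + 2) → α) → C, ¬ HasRainbowFamily k c →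
      (k - 2) * Fintype.card α ^ m + 1 ≤
        (Set.range fun g : Fin (m + 1) → α => c (Fin.cons (g 0) g)).ncard →
      (k - 2) * Fintype.card α ^ (m + 1) + 1 ≤ (Set.range c).ncard →
      ∃ (i : Fin (m + 2)) (S : Finset α) (c₀ : C), S.card + 2 = k ∧ ∀ e, e i ∉ S → c e = c₀) :
    ∃ (i : Fin (m + 2)) (S : Finset α) (c₀ : C), S.card + 2 = k ∧ ∀ e, e i ∉ S → c e = c₀ := by
  obtain ⟨t, ht⟩ := exists_lt_ncard_range_merge c hcard
  have hunshift : ∀ e : Fin (m + 2) → α,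
      c (Fin.cons ((Fin.cons (e 0 - t) (Fin.tail e) : Fin (m + 2) → α) 0 + t)
        (Fin.tail (Fin.cons (e 0 - t) (Fin.tail e) : Fin (m + 2) → α))) = c e := fun e => by
    rw [Fin.cons_zero, Fin.tail_cons, sub_add_cancel, Fin.cons_self_tail]
  have hrange : (Set.range fun f : Fin (m + 2) → α => c (Fin.cons (f 0 + t) (Fin.tail f))) =
      Set.range c := by
    ext a
    constructor
    · rintro ⟨f, rfl⟩
      exact ⟨_, rfl⟩
    · rintro ⟨e, rfl⟩
      exact ⟨_, hunshift e⟩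
  obtain ⟨i, S, c₀, hS, heq⟩ := h (fun f => c (Fin.cons (f 0 + t) (Fin.tail f)))
    (fun h => hc h.of_shift) ht (by rwa [hrange])
  refine ⟨i, if i = 0 then S.map (Equiv.addRight t).toEmbedding else S, c₀, ?_, fun e he => ?_⟩
  · split_ifs
    · rwa [Finset.card_map]
    · exact hS
  · rw [← hunshift e]
    refine heq _ ?_
    rcases Fin.eq_zero_or_eq_succ i with rfl | ⟨j, rfl⟩
    · rw [if_pos rfl] at he
      intro h0
      exact he (Finset.mem_map.2 ⟨_, h0, by simp⟩)
    · rw [if_neg (Fin.succ_ne_zero j)] at he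
      exact he

/-- A coloring with at least `(k - 2) * n ^ (m + 1) + 1` colors and no rainbow `k`-matching is
constant on the edges that avoid some set of `k - 2` vertices of one class. -/
theorem exists_eq_of_notMem {α C : Type*} [AddCommGroup α] [Fintype α] [DecidableEq α] {k : ℕ}
    (hk2 : 2 ≤ k) (hk : k + 2 ≤ Fintype.card α) (m : ℕ) (c : (Fin (m + 2) → α) → C)
    (hc : ¬ HasRainbowFamily k c)
    (hcard : (k - 2) * Fintype.card α ^ (m + 1) + 1 ≤ (Set.range c).ncard) :
    ∃ (i : Fin (m + 2)) (S : Finset α) (c₀ : C), S.card + 2 = k ∧ ∀ e, e i ∉ S → c e = c₀ := by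
  have hpow : ∀ {S : Finset α} {a : ℕ}, S.card + 2 = k → (k - 2) * Fintype.card α ^ a =
      S.card * Fintype.card α ^ a := by
    rintro S a rfl; rfl
  induction m with
  | zero =>
    refine exists_eq_of_notMem_of_shift c hc hcard fun c hc hdiag hcard => ?_
    rw [pow_zero, mul_one] at hdiag
    obtain ⟨S, c₀, hS, hstar⟩ := exists_isStarColoring_one hk2 hk c hc
      ((by omega : k ≤ k - 2 + 1 + 1).trans (Nat.succ_le_succ hdiag)) (by simpa using hcard)
    rw [hpow hS] at hcard
    obtain ⟨i, hi⟩ := exists_eq_of_notMem_of_merge hS (by omega) hc hstar hcard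
    exact ⟨i, S, c₀, hS, hi⟩
  | succ m ih =>
    refine exists_eq_of_notMem_of_shift c hc hcard fun c hc hdiag hcard => ?_
    obtain ⟨i, S, c₀, hS, heq⟩ := ih _ (fun h => hc h.of_merge) hdiag
    rw [hpow hS] at hcard hdiag
    obtain ⟨i, hi⟩ := exists_eq_of_notMem_of_merge hS (by omega) hc
      (isStarColoring_of_card_le heq hdiag) hcard
    exact ⟨i, S, c₀, hS, hi⟩

/-! ### Transfer to hypergraphs -/

/-- The edge of the complete `r`-partite hypergraph that meets the `i`-th class in `f i`. -/
def edgeOf {r : ℕ} {n : Fin r → ℕ} (f : ∀ i, Fin (n i)) : (completePartite n).edgeSet :=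
  ⟨{v | v.2 = f v.1}, fun i => by
    rw [Set.ncard_eq_one]
    refine ⟨⟨i, f i⟩, ?_⟩
    ext ⟨j, x⟩
    simp only [Set.mem_inter_iff, Set.mem_ofPred_eq, Set.mem_singleton_iff]
    constructor
    · rintro ⟨rfl, rfl⟩; rfl
    · rintro h
      cases h
      exact ⟨rfl, rfl⟩⟩

lemma mem_edgeOf {r : ℕ} {n : Fin r → ℕ} {f : ∀ i, Fin (n i)} {i : Fin r} {x : Fin (n i)} :
    (⟨i, x⟩ : Vertex n) ∈ (edgeOf f : Set (Vertex n)) ↔ x = f i :=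
  Iff.rfl

lemma edgeOf_bijective {r : ℕ} {n : Fin r → ℕ} :
    Function.Bijective (edgeOf : (∀ i, Fin (n i)) → (completePartite n).edgeSet) := by
  constructor
  · intro f g h
    funext i
    have : (⟨i, f i⟩ : Vertex n) ∈ (edgeOf g : Set (Vertex n)) := h ▸ mem_edgeOf.2 rfl
    exact mem_edgeOf.1 this
  · rintro ⟨e, he⟩
    have h : ∀ i, ∃ x : Fin (n i), e ∩ {v | v.1 = i} = {⟨i, x⟩} := by
      intro i
      obtain ⟨⟨j, x⟩, hx⟩ := Set.ncard_eq_one.1 (he i)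
      obtain rfl : j = i := (hx ▸ Set.mem_singleton _ : (⟨j, x⟩ : Vertex n) ∈ e ∩ _).2
      exact ⟨x, hx⟩
    choose f hf using h
    refine ⟨f, Subtype.ext ?_⟩
    ext ⟨i, x⟩
    rw [mem_edgeOf]
    have : (⟨i, x⟩ : Vertex n) ∈ e ↔ (⟨i, x⟩ : Vertex n) ∈ e ∩ {v | v.1 = i} := by simp
    rw [this, hf i]
    simp

lemma disjoint_edgeOf {r : ℕ} {n : Fin r → ℕ} {f g : ∀ i, Fin (n i)} :
    Disjoint (edgeOf f : Set (Vertex n)) (edgeOf g : Set (Vertex n)) ↔ ∀ i, f i ≠ g i := by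
  rw [Set.disjoint_left]
  constructor
  · intro h i hi
    exact h (mem_edgeOf.2 rfl) (mem_edgeOf.2 hi)
  · rintro h ⟨i, x⟩ hf hg
    exact h i ((mem_edgeOf.1 hf).symm.trans (mem_edgeOf.1 hg))

lemma edgeOf_mem_edgesMeeting {r : ℕ} {n : Fin r → ℕ} {f : ∀ i, Fin (n i)} {i : Fin r}
    {S : Finset (Fin (n i))} : edgeOf f ∈ edgesMeeting i S ↔ f i ∈ S := by
  constructor
  · rintro ⟨x, hx, h⟩
    exact mem_edgeOf.1 h ▸ hx
  · exact fun h => ⟨f i, h, mem_edgeOf.2 rfl⟩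

lemma HasRainbowFamily.hasRainbowMatching {r N k : ℕ} {C : Type*}
    {c : (completePartite fun _ : Fin (r + 1) => N).edgeSet → C}
    (h : HasRainbowFamily k fun f : Fin (r + 1) → Fin N => c (edgeOf f)) :
    HasRainbowMatching k c := by
  classical
  obtain ⟨X, u, hX, hu, hinj⟩ := h
  have hinj' : Set.InjOn (fun a => (edgeOf (u a) : (completePartite fun _ => N).edgeSet)) X :=
    fun a ha b hb hab => hinj ha hb (congrArg c hab)
  refine ⟨X.image fun a => edgeOf (u a), ?_, ?_, ?_⟩
  · rw [Finset.card_image_of_injOn hinj', hX]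
  · intro e he f hf hef
    obtain ⟨a, ha, rfl⟩ := Finset.mem_image.1 he
    obtain ⟨b, hb, rfl⟩ := Finset.mem_image.1 hf
    exact disjoint_edgeOf.2 (hu a ha b hb fun h => hef (h ▸ rfl))
  · intro e he f hf hef
    obtain ⟨a, ha, rfl⟩ := Finset.mem_image.1 (Finset.mem_coe.1 he)
    obtain ⟨b, hb, rfl⟩ := Finset.mem_image.1 (Finset.mem_coe.1 hf)
    rw [hinj ha hb hef]

lemma IsPhi.not_hasRainbowMatching {r k : ℕ} {n : Fin r → ℕ} {C : Type*} (hk : 2 ≤ k)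
    {c : (completePartite n).edgeSet → C} (h : IsPhi k c) : ¬ HasRainbowMatching k c := by
  classical
  obtain ⟨i, -, S, hS, -, c₀, -, hc₀⟩ := h
  rintro ⟨M, hM, hdisj, hinj⟩
  have h1 : (M.filter fun e => e ∈ edgesMeeting i S).card ≤ S.card := by
    have hex : ∀ e : (completePartite n).edgeSet, ∃ x, (⟨i, x⟩ : Vertex n) ∈ (e : Set (Vertex n)) ∧
        (e ∈ edgesMeeting i S → x ∈ S) := by
      intro e
      obtain ⟨f, rfl⟩ := edgeOf_bijective.surjective e
      exact ⟨f i, mem_edgeOf.2 rfl, edgeOf_mem_edgesMeeting.1⟩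
    choose p hp hpS using hex
    refine Finset.card_le_card_of_injOn p (fun e he => hpS e (Finset.mem_filter.1 he).2) ?_
    intro e he f hf hef
    have he := Finset.mem_filter.1 (Finset.mem_coe.1 he)
    have hf := Finset.mem_filter.1 (Finset.mem_coe.1 hf)
    by_contra hne
    exact Set.disjoint_left.1 (hdisj e he.1 f hf.1 hne) (hp e) (hef ▸ hp f)
  have h2 : (M.filter fun e => e ∉ edgesMeeting i S).card ≤ 1 := by
    refine Finset.card_le_one.2 fun e he f hf => ?_
    have he := Finset.mem_filter.1 he
    have hf := Finset.mem_filter.1 hf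
    exact hinj he.1 hf.1 ((hc₀ e he.2).trans (hc₀ f hf.2).symm)
  have h3 := Finset.card_filter_add_card_filter_not (s := M) fun e => e ∈ edgesMeeting i S
  omega

lemma ncard_edgesMeeting {m N : ℕ} (i : Fin (m + 1)) (S : Finset (Fin N)) :
    (edgesMeeting (n := fun _ : Fin (m + 1) => N) i S).ncard = S.card * N ^ m := by
  have : edgesMeeting (n := fun _ : Fin (m + 1) => N) i S =
      edgeOf '' {f : Fin (m + 1) → Fin N | f i ∈ S} := by
    ext e
    obtain ⟨f, rfl⟩ := edgeOf_bijective.surjective e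
    rw [edgeOf_mem_edgesMeeting, edgeOf_bijective.injective.mem_set_image]
    rfl
  rw [this, Set.ncard_image_of_injective _ edgeOf_bijective.injective, ncard_setOf_apply_mem,
    Fintype.card_fin]

lemma IsPhi.numColors_eq {m N k : ℕ} {C : Type*} (hN : k - 2 < N)
    {c : (completePartite fun _ : Fin (m + 1) => N).edgeSet → C} (h : IsPhi k c) :
    numColors c = (k - 2) * N ^ m + 1 := by
  obtain ⟨i, -, S, hS, hinj, c₀, hne, hc₀⟩ := h
  have hfin : Finite (completePartite fun _ : Fin (m + 1) => N).edgeSet :=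
    Finite.of_surjective _ edgeOf_bijective.surjective
  have hrange : Set.range c = insert c₀ (c '' edgesMeeting i S) := by
    ext a
    constructor
    · rintro ⟨e, rfl⟩
      by_cases he : e ∈ edgesMeeting i S
      · exact Or.inr ⟨e, he, rfl⟩
      · exact Or.inl (hc₀ e he)
    · rintro (rfl | ⟨e, -, rfl⟩)
      · obtain ⟨z, hz⟩ := exists_notMem_of_card_lt S (by rw [Fintype.card_fin]; exact hS ▸ hN)
        exact ⟨edgeOf fun _ => z, hc₀ _ fun h => hz (edgeOf_mem_edgesMeeting.1 h)⟩
      · exact ⟨e, rfl⟩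
  have hc : c₀ ∉ c '' edgesMeeting i S := by
    rintro ⟨e, he, h⟩
    exact hne e he h
  rw [numColors, hrange, Set.ncard_insert_of_notMem hc, hinj.ncard_image, ncard_edgesMeeting, hS]

lemma exists_isPhi {m N k : ℕ} (hN : k - 2 ≤ N) :
    ∃ c : (completePartite fun _ : Fin (m + 1) => N).edgeSet → ℕ, IsPhi k c := by
  classical
  have hfin : Finite (completePartite fun _ : Fin (m + 1) => N).edgeSet :=
    Finite.of_surjective _ edgeOf_bijective.surjective
  obtain ⟨φ, hφ⟩ := exists_injective_nat (completePartite fun _ : Fin (m + 1) => N).edgeSet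
  obtain ⟨S, -, hS⟩ := Finset.exists_subset_card_eq
    (s := (Finset.univ : Finset (Fin N))) (n := k - 2) (by simpa using hN)
  refine ⟨fun e => if e ∈ edgesMeeting 0 S then φ e + 1 else 0, 0, fun _ => le_rfl, S, hS,
    fun e he f hf h => ?_, 0, fun e he => by simp [he], fun e he => by simp [he]⟩
  simp only [if_pos he, if_pos hf] at h
  exact hφ (Nat.succ_injective h)

lemma isPhi_of_le_numColors {m N k : ℕ} {C : Type*} (hk : 2 ≤ k) (hN : k + 2 ≤ N)
    {c : (completePartite fun _ : Fin (m + 2) => N).edgeSet → C} (hc : ¬ HasRainbowMatching k c)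
    (hcard : (k - 2) * N ^ (m + 1) + 1 ≤ numColors c) : IsPhi k c := by
  have : NeZero N := ⟨by omega⟩
  have hrange : (Set.range fun f : Fin (m + 2) → Fin N => c (edgeOf f)) = Set.range c :=
    edgeOf_bijective.surjective.range_comp c
  obtain ⟨i, S, c₀, hS, heq⟩ := exists_eq_of_notMem hk (by simpa using hN) m
    (fun f : Fin (m + 2) → Fin N => c (edgeOf f)) (fun h => hc h.hasRainbowMatching)
    (by rw [hrange, Fintype.card_fin]; exact hcard)
  have hS' : S.card = k - 2 := by omega
  have hstar := isStarColoring_of_card_le heq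
    (by rw [hrange, Fintype.card_fin, hS']; exact hcard)
  refine ⟨i, fun _ => le_rfl, S, hS', ?_, c₀, ?_, ?_⟩
  · intro e he f hf h
    obtain ⟨e, rfl⟩ := edgeOf_bijective.surjective e
    obtain ⟨f, rfl⟩ := edgeOf_bijective.surjective f
    rw [hstar.injOn (edgeOf_mem_edgesMeeting.1 he) (edgeOf_mem_edgesMeeting.1 hf) h]
  · intro e he
    obtain ⟨e, rfl⟩ := edgeOf_bijective.surjective e
    exact hstar.ne e (edgeOf_mem_edgesMeeting.1 he)
  · intro e he
    obtain ⟨e, rfl⟩ := edgeOf_bijective.surjective e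
    exact hstar.eq e fun h => he (edgeOf_mem_edgesMeeting.2 h)

end PartiteAntiRamsey

theorem lemma1 (r k n₁ : ℕ) (hr : 2 ≤ r) (hk : 3 ≤ k) (hn : 2 * k - 1 ≤ n₁) :
    PartiteAntiRamsey.IsAntiRamseyNumber
        (PartiteAntiRamsey.completePartite (fun _ : Fin r => n₁)) k
        ((k - 2) * n₁ ^ (r - 1) + 1) ∧
      ∀ (C : Type*) (c : (PartiteAntiRamsey.completePartite (fun _ : Fin r => n₁)).edgeSet → C),
        (PartiteAntiRamsey.numColors c = (k - 2) * n₁ ^ (r - 1) + 1 ∧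
            ¬ PartiteAntiRamsey.HasRainbowMatching k c) ↔
          PartiteAntiRamsey.IsPhi k c := by
  obtain ⟨m, rfl⟩ : ∃ m, r = m + 2 := ⟨r - 2, by omega⟩
  rw [show m + 2 - 1 = m + 1 by omega]
  have hk2 : 2 ≤ k := by omega
  have hN : k + 2 ≤ n₁ := by omega
  refine ⟨⟨?_, ?_⟩, fun C c => ⟨fun h => ?_, fun h => ?_⟩⟩
  · obtain ⟨c, hc⟩ := PartiteAntiRamsey.exists_isPhi (m := m + 1) (N := n₁) (k := k) (by omega)
    exact ⟨c, hc.numColors_eq (by omega), hc.not_hasRainbowMatching hk2⟩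
  · rintro t ⟨c, rfl, hc⟩
    by_contra! hlt
    have := (PartiteAntiRamsey.isPhi_of_le_numColors hk2 hN hc hlt.le).numColors_eq (by omega)
    omega
  · exact PartiteAntiRamsey.isPhi_of_le_numColors hk2 hN h.2 h.1.ge
  · exact ⟨h.numColors_eq (by omega), h.not_hasRainbowMatching hk2⟩
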